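/- There exists a set $T$ of topologies on $\mathbb{R}$ of cardinality exactly $\mathfrak{c}=2^{\aleph_0}$ such that every $\tau\in T$ is finer than (or equal to) the Euclidean topology and the space $(\mathbb{R},\tau)$ is connected, separable and completely metrizable, and such that the spaces $(\mathbb{R},\tau)$, $\tau\in T$, are incomparable: whenever $\tau,\sigma\in T$ and $(\mathbb{R},\tau)$ is homeomorphic to a subspace $S\subseteq\mathbb{R}$ of $(\mathbb{R},\sigma)$, then $\tau=\sigma$ and $S=\mathbb{R}$. (That is, distinct topologies in $T$ give non-homeomorphic spaces, and no space $(\mathbb{R},\tau)$ with $\tau\in T$ is homeomorphic to a proper subspace of itself or of any other $(\mathbb{R},\sigma)$ with $\sigma\in T$.) -/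

import Mathlib

/-- The spaces `(α, τ)`, for `τ` in the family `T` of topologies on `α`, are *incomparable*:
`(α, τ)` is homeomorphic to a subspace `S` of `(α, σ)` only in the trivial case where
`(α, τ)`, `S` and `(α, σ)` are all the same space. -/
def IncomparableTopologies {α : Type*} (T : Set (TopologicalSpace α)) : Prop :=
  ∀ τ ∈ T, ∀ σ ∈ T, ∀ S : Set α,
    Nonempty (@Homeomorph α S τ (TopologicalSpace.induced Subtype.val σ)) →
      τ = σ ∧ S = Set.univ

/-- The Euclidean topology on the real line (the standard one of Mathlib).
For a topology `τ`, the relation `τ ≤ euclideanTopology` says that `τ` is finer, that is,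
every Euclidean open set is `τ`-open. -/
abbrev euclideanTopology : TopologicalSpace ℝ := inferInstance

/- For a set `Q` of integers let `f` be the product of `sin (1 / d(x, ℤ))` with a weight which tends
to `1` at every integer from the right, and from the left tends to `1` at the integers of `Q` and
to `0` at the others. Retopologise `ℝ` as the graph of `f`. This space is connected, since each
point `(n, 0)` is a limit of zeros of `f` from either side, and Polish, since the graph is a `Gδ`
set in the plane.

An embedding `h` of one such space into another sends intervals to intervals, hence is strictly
monotone or strictly antitone. One-sided continuity at a point is preserved by `h`, up to exchanging
the sides if `h` is antitone. Since `f` is discontinuous from the right exactly on `ℤ` and from the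
left exactly on `Q`, choosing all the sets `Q` with least element `0` forces `h` to be increasing
and to restrict to a bijection of `ℤ` that matches the sets `Q`, hence to the identity of `ℤ`. -/

open Set Filter Topology TopologicalSpace

section Gδ

variable {X Y : Type*} [TopologicalSpace X] [TopologicalSpace Y]

theorem polishSpace_coe_of_isGδ [PolishSpace X] {s : Set X} (hs : IsGδ s) : PolishSpace s := by
  obtain ⟨U, hU, rfl⟩ := isGδ_iff_eq_iInter_nat.1 hs
  have (n : ℕ) : PolishSpace (U n) := (hU n).polishSpace
  let diag (x : ↥(⋂ n, U n)) (n : ℕ) : U n := ⟨x, mem_iInter.1 x.2 n⟩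
  have hdiag : IsEmbedding diag :=
    .of_comp (continuous_pi fun n => continuous_subtype_val.subtype_mk _)
      (continuous_subtype_val.comp (continuous_apply 0)) IsEmbedding.subtypeVal
  have hrange : range diag = ⋂ n, {w | (w n : X) = w 0} := by
    refine Subset.antisymm ?_ fun w hw => ?_
    · rintro _ ⟨x, rfl⟩
      exact mem_iInter.2 fun n => rfl
    · have hw (n : ℕ) : (w n : X) = w 0 := mem_iInter.1 hw n
      exact ⟨⟨w 0, mem_iInter.2 fun n => hw n ▸ (w n).2⟩, funext fun n => Subtype.ext (hw n).symm⟩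
  refine IsClosedEmbedding.polishSpace (f := diag) ⟨hdiag, hrange ▸ isClosed_iInter fun n => ?_⟩
  exact isClosed_eq (by fun_prop) (by fun_prop)

theorem polishSpace_of_isEmbedding_of_isGδ_range [PolishSpace Y] {f : X → Y} (hf : IsEmbedding f)
    (hr : IsGδ (range f)) : PolishSpace X :=
  have := polishSpace_coe_of_isGδ hr
  hf.toHomeomorph.isClosedEmbedding.polishSpace

theorem isGδ_graphOn_of_continuousOn [PseudoMetrizableSpace X] [MetrizableSpace Y] {f : X → Y}
    {s : Set X} (hs : IsGδ s) (hf : ContinuousOn f s) : IsGδ (s.graphOn f) := by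
  suffices s.graphOn f = closure (s.graphOn f) ∩ Prod.fst ⁻¹' s by
    rw [this]
    exact isClosed_closure.isGδ.inter (hs.preimage continuous_fst)
  refine Subset.antisymm (subset_inter subset_closure ?_) ?_
  · rintro _ ⟨x, hx, rfl⟩
    exact hx
  · rintro ⟨x, y⟩ ⟨hxy, hx⟩
    have : (𝓝[s.graphOn f] (x, y)).NeBot := mem_closure_iff_nhdsWithin_neBot.1 hxy
    have hfst : Tendsto Prod.fst (𝓝[s.graphOn f] (x, y)) (𝓝[s] x) :=
      continuous_fst.continuousWithinAt.tendsto_nhdsWithin (by rintro _ ⟨x, hx, rfl⟩; exact hx)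
    have hsnd : Tendsto Prod.snd (𝓝[s.graphOn f] (x, y)) (𝓝 y) :=
      continuous_snd.continuousWithinAt
    have heq : f ∘ Prod.fst =ᶠ[𝓝[s.graphOn f] (x, y)] Prod.snd := by
      filter_upwards [self_mem_nhdsWithin]
      rintro _ ⟨x, -, rfl⟩
      rfl
    have hfx : Tendsto Prod.snd (𝓝[s.graphOn f] (x, y)) (𝓝 (f x)) :=
      ((hf x hx).tendsto.comp hfst).congr' heq
    exact ⟨x, hx, Prod.ext rfl (tendsto_nhds_unique hfx hsnd)⟩

theorem isGδ_range_graph_of_isClosed [PseudoMetrizableSpace X] [MetrizableSpace Y] {f : X → Y}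
    {Z : Set X} (hZ : IsClosed Z) (hf : ContinuousOn f Z) (hf' : ContinuousOn f Zᶜ) :
    IsGδ (range fun x => (x, f x)) := by
  have h : range (fun x => (x, f x)) = Z.graphOn f ∪ Zᶜ.graphOn f := by
    rw [graphOn, graphOn, ← image_union, union_compl_self, image_univ]
  rw [h]
  exact (isGδ_graphOn_of_continuousOn hZ.isGδ hf).union
    (isGδ_graphOn_of_continuousOn hZ.isOpen_compl.isGδ hf')

end Gδ

section ConnectedGraph

variable {X Y : Type*} [TopologicalSpace X] [TopologicalSpace Y]

theorem isPreconnected_graphOn_of_continuousOn {f : X → Y} {s : Set X} (hs : IsPreconnected s)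
    (hf : ContinuousOn f s) : IsPreconnected (s.graphOn f) :=
  hs.image _ (continuousOn_id.prodMk hf)

theorem mem_closure_graphOn_of_mapClusterPt {f : X → Y} {s : Set X} {x : X}
    (h : MapClusterPt (f x) (𝓝[s] x) f) : (x, f x) ∈ closure (s.graphOn f) := by
  refine (mem_closure_iff_nhds_basis ((𝓝 x).basis_sets.prod_nhds (𝓝 (f x)).basis_sets)).2 ?_
  rintro ⟨u, v⟩ ⟨hu, hv⟩
  have hsu : s ∩ u ∈ 𝓝[s] x := inter_mem_nhdsWithin s hu
  obtain ⟨y, hyv, hys, hyu⟩ := ((mapClusterPt_iff_frequently.1 h v hv).and_eventually hsu).exists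
  exact ⟨(y, f y), mem_image_of_mem _ hys, hyu, hyv⟩

theorem isPreconnected_graphOn_insert {f : X → Y} {s : Set X} {x : X}
    (hs : IsPreconnected (s.graphOn f)) (hx : MapClusterPt (f x) (𝓝[s] x) f) :
    IsPreconnected ((insert x s).graphOn f) := by
  refine hs.subset_closure (image_mono (subset_insert x s)) ?_
  rw [graphOn, image_insert_eq]
  exact insert_subset (mem_closure_graphOn_of_mapClusterPt hx) subset_closure

theorem isPreconnected_graphOn_of_eventually {f : X → Y} {s : Set X} (hs : IsPreconnected s)
    (h : ∀ x ∈ s, ∀ᶠ y in 𝓝[s] x, ∃ t ⊆ s, x ∈ t ∧ y ∈ t ∧ IsPreconnected (t.graphOn f)) :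
    IsPreconnected (s.graphOn f) := by
  refine isPreconnected_of_forall_pair ?_
  rintro _ ⟨x, hx, rfl⟩ _ ⟨y, hy, rfl⟩
  obtain ⟨t, hts, hxt, hyt, ht⟩ := hs.induction₂
    (fun x y => ∃ t ⊆ s, x ∈ t ∧ y ∈ t ∧ IsPreconnected (t.graphOn f)) h
    (fun x y z _ _ _ ⟨t, hts, hxt, hyt, ht⟩ ⟨u, hus, hyu, hzu, hu⟩ =>
      ⟨t ∪ u, union_subset hts hus, .inl hxt, .inr hzu, by
        rw [graphOn, image_union]
        exact ht.union (y, f y) (mem_image_of_mem _ hyt) (mem_image_of_mem _ hyu) hu⟩)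
    (fun x y _ _ ⟨t, hts, hxt, hyt, ht⟩ => ⟨t, hts, hyt, hxt, ht⟩) hx hy
  exact ⟨t.graphOn f, image_mono hts, mem_image_of_mem _ hxt, mem_image_of_mem _ hyt, ht⟩

variable {α : Type*} [ConditionallyCompleteLinearOrder α] [DenselyOrdered α] [TopologicalSpace α]
  [OrderTopology α]

theorem eventually_nhdsGT_isPreconnected_graphOn_uIcc [NoMaxOrder α] {f : α → Y} {x : α}
    (hc : ∀ᶠ y in 𝓝[>] x, ContinuousAt f y) (hx : MapClusterPt (f x) (𝓝[>] x) f) :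
    ∀ᶠ y in 𝓝[>] x, IsPreconnected ((uIcc x y).graphOn f) := by
  obtain ⟨u, hxu, hu⟩ := mem_nhdsGT_iff_exists_Ioo_subset.1 hc
  filter_upwards [Ioo_mem_nhdsGT hxu] with y hy
  have hIoc : IsPreconnected ((Ioc x y).graphOn f) :=
    isPreconnected_graphOn_of_continuousOn isPreconnected_Ioc fun z hz =>
      (hu ⟨hz.1, hz.2.trans_lt hy.2⟩).continuousWithinAt
  rw [uIcc_of_le hy.1.le, ← Ioc_insert_left hy.1.le]
  exact isPreconnected_graphOn_insert hIoc (by rwa [nhdsWithin_Ioc_eq_nhdsGT hy.1])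

theorem eventually_nhdsLT_isPreconnected_graphOn_uIcc [NoMinOrder α] {f : α → Y} {x : α}
    (hc : ∀ᶠ y in 𝓝[<] x, ContinuousAt f y) (hx : MapClusterPt (f x) (𝓝[<] x) f) :
    ∀ᶠ y in 𝓝[<] x, IsPreconnected ((uIcc x y).graphOn f) := by
  refine (eventually_nhdsGT_isPreconnected_graphOn_uIcc (α := αᵒᵈ) (f := f ∘ OrderDual.ofDual)
    (x := OrderDual.toDual x) hc hx).mono fun y hy => ?_
  rwa [← OrderDual.toDual_ofDual y, uIcc_toDual] at hy

theorem isPreconnected_graphOn_of_mapClusterPt [NoMinOrder α] [NoMaxOrder α] {f : α → Y}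
    (hc : ∀ x, ∀ᶠ y in 𝓝[≠] x, ContinuousAt f y) (hr : ∀ x, MapClusterPt (f x) (𝓝[>] x) f)
    (hl : ∀ x, MapClusterPt (f x) (𝓝[<] x) f) {s : Set α} (hs : s.OrdConnected) :
    IsPreconnected (s.graphOn f) := by
  refine isPreconnected_graphOn_of_eventually hs.isPreconnected fun x hx => ?_
  have hloc : ∀ᶠ y in 𝓝 x, IsPreconnected ((uIcc x y).graphOn f) := by
    rw [← nhdsNE_sup_pure, ← nhdsLT_sup_nhdsGT, eventually_sup, eventually_sup]
    refine ⟨⟨?_, ?_⟩, ?_⟩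
    · exact eventually_nhdsLT_isPreconnected_graphOn_uIcc
        ((hc x).filter_mono (nhdsLT_le_nhdsNE x)) (hl x)
    · exact eventually_nhdsGT_isPreconnected_graphOn_uIcc
        ((hc x).filter_mono (nhdsGT_le_nhdsNE x)) (hr x)
    · simp [graphOn, isPreconnected_singleton]
  filter_upwards [hloc.filter_mono nhdsWithin_le_nhds, self_mem_nhdsWithin] with y hy hys
  exact ⟨uIcc x y, hs.uIcc_subset hx hys, left_mem_uIcc, right_mem_uIcc, hy⟩

end ConnectedGraph

section GraphTopology

variable {X Y X' Y' : Type*} [TopologicalSpace X] [TopologicalSpace Y] [TopologicalSpace X']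
  [TopologicalSpace Y']

/-- The graph of `f : X → Y` as a topological space, transported to `X`: the coarsest topology that
is finer than the given one and makes `f` continuous. -/
abbrev graphTopology (f : X → Y) : TopologicalSpace X :=
  .induced (fun x => (x, f x)) inferInstance

theorem isEmbedding_graphTopology (f : X → Y) :
    @IsEmbedding X (X × Y) (graphTopology f) _ fun x => (x, f x) :=
  @IsEmbedding.mk X (X × Y) (graphTopology f) _ _
    (@IsInducing.mk X (X × Y) (graphTopology f) _ _ rfl) fun _ _ h => congrArg Prod.fst h

theorem graphTopology_le (f : X → Y) : graphTopology f ≤ ‹TopologicalSpace X› :=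
  fun s hs => ⟨Prod.fst ⁻¹' s, hs.preimage continuous_fst, rfl⟩

theorem tendsto_nhds_graphTopology {ι : Type*} {l : Filter ι} {u : ι → X} {f : X → Y} {x : X} :
    Tendsto u l (@nhds X (graphTopology f) x) ↔
      Tendsto u l (𝓝 x) ∧ Tendsto (f ∘ u) l (𝓝 (f x)) := by
  rw [nhds_induced, tendsto_comap_iff, Prod.tendsto_iff]
  rfl

theorem isPreconnected_graphTopology_iff {f : X → Y} {s : Set X} :
    @IsPreconnected X (graphTopology f) s ↔ IsPreconnected (s.graphOn f) :=
  (@IsInducing.isPreconnected_image X (X × Y) (graphTopology f) _ _ _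
    (@IsEmbedding.isInducing X (X × Y) _ (graphTopology f) _ (isEmbedding_graphTopology f))).symm

theorem polishSpace_graphTopology [PolishSpace X] [PolishSpace Y] {f : X → Y}
    (hf : IsGδ (range fun x => (x, f x))) : @PolishSpace X (graphTopology f) :=
  @polishSpace_of_isEmbedding_of_isGδ_range X (X × Y) (graphTopology f) _ _ _
    (isEmbedding_graphTopology f) hf

variable {f : X → Y} {g : X' → Y'} {h : X → X'}

theorem tendsto_iff_of_graphTopology_eq_induced
    (hfg : graphTopology f = .induced h (graphTopology g)) {l : Filter X} {x : X} (hl : l ≤ 𝓝 x)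
    (hl' : map h l ≤ 𝓝 (h x)) :
    Tendsto f l (𝓝 (f x)) ↔ Tendsto g (map h l) (𝓝 (g (h x))) :=
  calc
    Tendsto f l (𝓝 (f x)) ↔ Tendsto id l (@nhds X (graphTopology f) x) := by
      rw [tendsto_nhds_graphTopology, Function.comp_id]
      exact (and_iff_right hl).symm
    _ ↔ Tendsto h l (@nhds X' (graphTopology g) (h x)) := by
      rw [hfg, @nhds_induced X' X (graphTopology g), tendsto_comap_iff, Function.comp_id]
    _ ↔ Tendsto g (map h l) (𝓝 (g (h x))) := by
      rw [tendsto_nhds_graphTopology, tendsto_map'_iff]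
      exact and_iff_right hl'

theorem isPreconnected_image_of_graphTopology_eq_induced
    (hfg : graphTopology f = .induced h (graphTopology g)) {s : Set X}
    (hs : IsPreconnected (s.graphOn f)) : IsPreconnected (h '' s) := by
  have hcont : Continuous[graphTopology f, _] h := by
    rw [continuous_iff_le_induced, hfg]
    exact induced_mono (graphTopology_le g)
  exact @IsPreconnected.image X X' (graphTopology f) _ s (isPreconnected_graphTopology_iff.2 hs) h
    (@Continuous.continuousOn X X' (graphTopology f) _ h s hcont)

end GraphTopology

section OrderEmbedding

variable {α β : Type*} [LinearOrder α] [LinearOrder β] {h : α → β}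

theorem lt_iff_lt_of_ordConnected {s : Set α} (hs : s.OrdConnected) {a b c : α} (ha : a ∈ s)
    (hb : b ∈ s) (hc : c ∉ s) : a < c ↔ b < c := by
  have key {a b : α} (ha : a ∈ s) (hb : b ∈ s) (hac : a < c) : b < c :=
    lt_of_not_ge fun hcb => hc (hs.out ha hb ⟨hac.le, hcb⟩)
  exact ⟨key ha hb, key hb ha⟩

theorem strictMono_or_strictAnti_of_ordConnected_image (hinj : Function.Injective h)
    (himg : ∀ s : Set α, s.OrdConnected → (h '' s).OrdConnected) :
    StrictMono h ∨ StrictAnti h := by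
  have move_left {x x' y : α} (hxy : x < y) (hxy' : x' < y) : h x < h y ↔ h x' < h y :=
    lt_iff_lt_of_ordConnected (himg _ ordConnected_Iio) (mem_image_of_mem h hxy)
      (mem_image_of_mem h hxy') (by simp [hinj.mem_set_image])
  have move_right {x y y' : α} (hxy : x < y) (hxy' : x < y') : h y < h x ↔ h y' < h x :=
    lt_iff_lt_of_ordConnected (himg _ ordConnected_Ioi) (mem_image_of_mem h hxy)
      (mem_image_of_mem h hxy') (by simp [hinj.mem_set_image])
  have not_lt_iff {x y : α} (hxy : x < y) : ¬h y < h x ↔ h x < h y :=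
    not_lt.trans (hinj.ne hxy.ne).le_iff_lt
  have same_sign {x y x' y' : α} (hxy : x < y) (hxy' : x' < y') : h x < h y ↔ h x' < h y' := by
    have hx : x < max y y' := hxy.trans_le (le_max_left _ _)
    have hx' : x' < max y y' := hxy'.trans_le (le_max_right _ _)
    rw [← not_lt_iff hxy, move_right hxy hx, not_lt_iff hx, move_left hx hx', ← not_lt_iff hx',
      move_right hx' hxy', not_lt_iff hxy']
  by_cases hex : ∃ x y, x < y ∧ h x < h y
  · obtain ⟨x, y, hxy, hh⟩ := hex
    exact .inl fun _ _ hxy' => (same_sign hxy hxy').1 hh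
  · push Not at hex
    exact .inr fun x y hxy => (hex x y hxy).lt_of_ne (hinj.ne hxy.ne')

variable [TopologicalSpace α] [OrderTopology α] [TopologicalSpace β] [OrderTopology β]

theorem map_nhdsGT_of_strictMono [NoMaxOrder α] (hm : StrictMono h) (hr : (range h).OrdConnected)
    (x : α) : map h (𝓝[>] x) = 𝓝[>] (h x) := by
  obtain ⟨y, hxy⟩ := exists_gt x
  rw [(hm.isEmbedding_of_ordConnected hr).map_nhdsWithin_eq]
  refine le_antisymm (nhdsWithin_mono _ ?_) (nhdsWithin_le_of_mem ?_)
  · rintro _ ⟨z, hz, rfl⟩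
    exact hm hz
  · filter_upwards [Ioo_mem_nhdsGT (hm hxy)] with z hz
    obtain ⟨w, rfl⟩ := hr.out (mem_range_self x) (mem_range_self y) (Ioo_subset_Icc_self hz)
    exact mem_image_of_mem h (hm.lt_iff_lt.1 hz.1)

theorem map_nhdsLT_of_strictMono [NoMinOrder α] (hm : StrictMono h) (hr : (range h).OrdConnected)
    (x : α) : map h (𝓝[<] x) = 𝓝[<] (h x) :=
  map_nhdsGT_of_strictMono (α := αᵒᵈ) (β := βᵒᵈ) hm.dual hr.dual x

theorem map_nhdsGT_of_strictAnti [NoMaxOrder α] (ha : StrictAnti h) (hr : (range h).OrdConnected)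
    (x : α) : map h (𝓝[>] x) = 𝓝[<] (h x) :=
  map_nhdsGT_of_strictMono (β := βᵒᵈ) ha.dual_right hr.dual x

end OrderEmbedding

section SineComb

theorem frequently_atTop_eq_of_periodic {α β : Type*} [AddCommGroup α] [LinearOrder α]
    [IsOrderedAddMonoid α] [Archimedean α] {f : α → β} {c : α} (hf : Function.Periodic f c)
    (hc : 0 < c) (a : α) : ∃ᶠ t in atTop, f t = f a :=
  frequently_atTop.2 fun b =>
    let ⟨t, ht, hft⟩ := hf.exists_mem_Ico hc a b
    ⟨t, ht.1, hft.symm⟩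

theorem tendsto_mul_nhds_zero_iff_of_frequently_eq_one {ι R : Type*} [NormedRing R] {l : Filter ι}
    {w g : ι → R} {c : R} (hw : Tendsto w l (𝓝 c)) (hg : IsBoundedUnder (· ≤ ·) l (norm ∘ g))
    (hg1 : ∃ᶠ x in l, g x = 1) : Tendsto (fun x => w x * g x) l (𝓝 0) ↔ c = 0 := by
  refine ⟨fun h => ?_, fun hc => (hc ▸ hw).zero_mul_isBoundedUnder_le hg⟩
  have hsub : Tendsto (fun x => w x * g x - w x) l (𝓝 (-c)) := zero_sub c ▸ h.sub hw
  refine neg_eq_zero.1 (isClosed_singleton.mem_of_frequently_of_tendsto (hg1.mono ?_) hsub)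
  intro x hx
  rw [hx, mul_one, sub_self, mem_singleton_iff]

/-- The oscillating factor `sin (1 / d(x, ℤ))`. It vanishes on `ℤ` because `0⁻¹ = 0`. -/
noncomputable def sinInvDist (x : ℝ) : ℝ :=
  Real.sin ‖(x : UnitAddCircle)‖⁻¹

open Classical in
/-- The weight that tends to `1` at every integer from the right, and whose limit from the left at
an integer `n` is `1` if `n ∈ Q` and `0` otherwise. -/
noncomputable def leftWeight (Q : Set ℤ) (x : ℝ) : ℝ :=
  if ⌈x⌉ ∈ Q then 1 else ⌈x⌉ - x

/-- The function whose graphs are the spaces of the family. It is discontinuous from the right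
exactly at the integers and discontinuous from the left exactly at the elements of `Q`. -/
noncomputable def sineComb (Q : Set ℤ) (x : ℝ) : ℝ :=
  leftWeight Q x * sinInvDist x

theorem sinInvDist_intCast (n : ℤ) : sinInvDist n = 0 := by
  have : ((n : ℝ) : UnitAddCircle) = 0 := (AddCircle.coe_eq_zero_iff 1).2 ⟨n, by simp⟩
  rw [sinInvDist, this, norm_zero, inv_zero, Real.sin_zero]

theorem sinInvDist_neg (x : ℝ) : sinInvDist (-x) = sinInvDist x := by
  rw [sinInvDist, AddCircle.coe_neg, norm_neg, sinInvDist]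

theorem continuousAt_sinInvDist {x : ℝ} (hx : x ∉ range ((↑) : ℤ → ℝ)) :
    ContinuousAt sinInvDist x := by
  have hnorm : ‖(x : UnitAddCircle)‖ ≠ 0 := by
    rw [norm_ne_zero_iff, Ne, AddCircle.coe_eq_zero_iff]
    rintro ⟨n, rfl⟩
    exact hx ⟨n, by simp⟩
  have hcont : Continuous fun y : ℝ => ‖(y : UnitAddCircle)‖ :=
    continuous_norm.comp (AddCircle.continuous_mk' 1)
  exact Real.continuous_sin.continuousAt.comp (hcont.continuousAt.inv₀ hnorm)

theorem sinInvDist_intCast_add_inv (n : ℤ) {t : ℝ} (ht : 2 ≤ t) :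
    sinInvDist (n + t⁻¹) = Real.sin t := by
  have ht0 : 0 < t := two_pos.trans_le ht
  have hcoe : ((n + t⁻¹ : ℝ) : UnitAddCircle) = (t⁻¹ : ℝ) := by
    rw [AddCircle.coe_add, (AddCircle.coe_eq_zero_iff 1).2 ⟨n, by simp⟩, zero_add]
  have hnorm : ‖((t⁻¹ : ℝ) : UnitAddCircle)‖ = t⁻¹ := by
    rw [(AddCircle.norm_coe_eq_abs_iff 1 one_ne_zero).2, abs_of_pos (inv_pos.2 ht0)]
    rw [abs_of_pos (inv_pos.2 ht0), abs_one, one_div]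
    exact inv_anti₀ two_pos ht
  rw [sinInvDist, hcoe, hnorm, inv_inv]

theorem frequently_nhdsGT_sinInvDist_eq (n : ℤ) (a : ℝ) :
    ∃ᶠ x in 𝓝[>] (n : ℝ), sinInvDist x = Real.sin a := by
  have hlim : Tendsto (fun t : ℝ => n + t⁻¹) atTop (𝓝[>] (n : ℝ)) := by
    refine tendsto_nhdsWithin_iff.2 ⟨?_, ?_⟩
    · simpa using tendsto_inv_atTop_zero.const_add (n : ℝ)
    · filter_upwards [eventually_gt_atTop 0] with t ht
      exact lt_add_of_pos_right _ (inv_pos.2 ht)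
  refine hlim.frequently (((frequently_atTop_eq_of_periodic Real.sin_periodic Real.two_pi_pos
    a).and_eventually (eventually_ge_atTop 2)).mono fun t ht => ?_)
  rw [sinInvDist_intCast_add_inv n ht.2, ht.1]

theorem frequently_nhdsLT_sinInvDist_eq (n : ℤ) (a : ℝ) :
    ∃ᶠ x in 𝓝[<] (n : ℝ), sinInvDist x = Real.sin a := by
  have hneg : Tendsto Neg.neg (𝓝[>] ((-n : ℤ) : ℝ)) (𝓝[<] (n : ℝ)) := by
    simpa using tendsto_neg_nhdsGT (a := ((-n : ℤ) : ℝ))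
  refine hneg.frequently ((frequently_nhdsGT_sinInvDist_eq (-n) a).mono fun x hx => ?_)
  rw [sinInvDist_neg, hx]

variable {Q : Set ℤ} {x : ℝ}

open Classical in
theorem tendsto_leftWeight {l : Filter ℝ} {m : ℤ} (hl : l ≤ 𝓝 x)
    (hm : Tendsto Int.ceil l (pure m)) :
    Tendsto (leftWeight Q) l (𝓝 (if m ∈ Q then 1 else m - x)) := by
  have heq : (fun y : ℝ => if m ∈ Q then 1 else m - y) =ᶠ[l] leftWeight Q := by
    filter_upwards [tendsto_pure.1 hm] with y hy
    rw [leftWeight, hy]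
  have hcont : Continuous fun y : ℝ => if m ∈ Q then 1 else m - y := by
    split_ifs <;> fun_prop
  exact (hcont.tendsto x |>.mono_left hl).congr' heq

theorem tendsto_leftWeight_nhdsGT (n : ℤ) : Tendsto (leftWeight Q) (𝓝[>] (n : ℝ)) (𝓝 1) := by
  simpa using tendsto_leftWeight (Q := Q) nhdsWithin_le_nhds (tendsto_ceil_right_pure_add_one n)

open Classical in
theorem tendsto_leftWeight_nhdsLT (n : ℤ) :
    Tendsto (leftWeight Q) (𝓝[<] (n : ℝ)) (𝓝 (if n ∈ Q then 1 else 0)) := by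
  simpa using tendsto_leftWeight (Q := Q) nhdsWithin_le_nhds
    ((tendsto_ceil_left_pure n).mono_left (nhdsWithin_mono _ Iio_subset_Iic_self))

theorem continuousAt_leftWeight (hx : x ∉ range ((↑) : ℤ → ℝ)) :
    ContinuousAt (leftWeight Q) x := by
  have hlt : x < ⌈x⌉ := (Int.le_ceil x).lt_of_ne fun h => hx ⟨_, h.symm⟩
  have hceil : Tendsto Int.ceil (𝓝 x) (pure ⌈x⌉) := by
    refine tendsto_pure.2 ?_
    filter_upwards [Ioo_mem_nhds (sub_lt_iff_lt_add.2 (Int.ceil_lt_add_one x)) hlt] with y hy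
    exact Int.ceil_eq_iff.2 ⟨hy.1, hy.2.le⟩
  exact tendsto_leftWeight le_rfl hceil

theorem sineComb_intCast (n : ℤ) : sineComb Q n = 0 := by
  rw [sineComb, sinInvDist_intCast, mul_zero]

theorem continuousAt_sineComb (hx : x ∉ range ((↑) : ℤ → ℝ)) : ContinuousAt (sineComb Q) x :=
  (continuousAt_leftWeight hx).mul (continuousAt_sinInvDist hx)

theorem tendsto_sineComb_iff_of_frequently {l : Filter ℝ} {c : ℝ}
    (hw : Tendsto (leftWeight Q) l (𝓝 c)) (hl : ∃ᶠ y in l, sinInvDist y = Real.sin (Real.pi / 2)) :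
    Tendsto (sineComb Q) l (𝓝 0) ↔ c = 0 :=
  tendsto_mul_nhds_zero_iff_of_frequently_eq_one hw
    (isBoundedUnder_of ⟨1, fun _ => Real.abs_sin_le_one _⟩) (Real.sin_pi_div_two ▸ hl)

theorem tendsto_sineComb_nhdsGT_iff :
    Tendsto (sineComb Q) (𝓝[>] x) (𝓝 (sineComb Q x)) ↔ x ∉ range ((↑) : ℤ → ℝ) := by
  refine ⟨?_, fun hx => (continuousAt_sineComb hx).tendsto.mono_left nhdsWithin_le_nhds⟩
  rintro h ⟨n, rfl⟩
  rw [sineComb_intCast, tendsto_sineComb_iff_of_frequently (tendsto_leftWeight_nhdsGT n)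
    (frequently_nhdsGT_sinInvDist_eq n _)] at h
  exact one_ne_zero h

theorem tendsto_sineComb_nhdsLT_iff :
    Tendsto (sineComb Q) (𝓝[<] x) (𝓝 (sineComb Q x)) ↔ x ∉ ((↑) : ℤ → ℝ) '' Q := by
  by_cases hx : x ∈ range ((↑) : ℤ → ℝ)
  · obtain ⟨n, rfl⟩ := hx
    rw [sineComb_intCast, tendsto_sineComb_iff_of_frequently (tendsto_leftWeight_nhdsLT n)
      (frequently_nhdsLT_sinInvDist_eq n _), Int.cast_injective.mem_set_image]
    simp
  · exact iff_of_true ((continuousAt_sineComb hx).tendsto.mono_left nhdsWithin_le_nhds)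
      fun h => hx (image_subset_range _ _ h)

theorem mapClusterPt_sineComb {l : Filter ℝ} [l.NeBot] (hl : l ≤ 𝓝 x)
    (hfreq : ∀ n : ℤ, x = n → ∃ᶠ y in l, sinInvDist y = Real.sin 0) :
    MapClusterPt (sineComb Q x) l (sineComb Q) := by
  by_cases hx : x ∈ range ((↑) : ℤ → ℝ)
  · obtain ⟨n, rfl⟩ := hx
    refine mapClusterPt_iff_frequently.2 fun s hs => (hfreq n rfl).mono fun y hy => ?_
    rw [sineComb, hy, Real.sin_zero, mul_zero, ← sineComb_intCast n]
    exact mem_of_mem_nhds hs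
  · exact ((continuousAt_sineComb hx).tendsto.mono_left hl).mapClusterPt

theorem eventually_nhdsNE_notMem_range_intCast (x : ℝ) :
    ∀ᶠ y in 𝓝[≠] x, y ∉ range ((↑) : ℤ → ℝ) := by
  have hclosed : IsClosed (((↑) : ℤ → ℝ) '' {n | (n : ℝ) ≠ x}) :=
    Int.isClosedEmbedding_coe_real.isClosedMap _ (isClosed_discrete _)
  have hmem : (((↑) : ℤ → ℝ) '' {n | (n : ℝ) ≠ x})ᶜ ∈ 𝓝 x :=
    hclosed.isOpen_compl.mem_nhds (by rintro ⟨n, hn, rfl⟩; exact hn rfl)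
  filter_upwards [nhdsWithin_le_nhds hmem, self_mem_nhdsWithin] with y hy hyx
  rintro ⟨n, rfl⟩
  exact hy ⟨n, hyx, rfl⟩

theorem isPreconnected_graphOn_sineComb {s : Set ℝ} (hs : s.OrdConnected) :
    IsPreconnected (s.graphOn (sineComb Q)) := by
  refine isPreconnected_graphOn_of_mapClusterPt (fun x => ?_) (fun x => ?_) (fun x => ?_) hs
  · exact (eventually_nhdsNE_notMem_range_intCast x).mono fun y => continuousAt_sineComb
  · exact mapClusterPt_sineComb nhdsWithin_le_nhds fun n hn =>
      hn ▸ frequently_nhdsGT_sinInvDist_eq n 0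
  · exact mapClusterPt_sineComb nhdsWithin_le_nhds fun n hn =>
      hn ▸ frequently_nhdsLT_sinInvDist_eq n 0

theorem connectedSpace_graphTopology_sineComb (Q : Set ℤ) :
    @ConnectedSpace ℝ (graphTopology (sineComb Q)) :=
  @ConnectedSpace.mk ℝ (graphTopology (sineComb Q))
    (@PreconnectedSpace.mk ℝ (graphTopology (sineComb Q))
      (isPreconnected_graphTopology_iff.2 (isPreconnected_graphOn_sineComb ordConnected_univ)))
    inferInstance

theorem polishSpace_graphTopology_sineComb (Q : Set ℤ) :
    @PolishSpace ℝ (graphTopology (sineComb Q)) := by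
  refine polishSpace_graphTopology (isGδ_range_graph_of_isClosed
    (Int.isClosedEmbedding_coe_real.isClosed_range) ?_ ?_)
  · refine (continuousOn_const (c := 0)).congr ?_
    rintro _ ⟨n, rfl⟩
    exact sineComb_intCast n
  · exact fun x hx => (continuousAt_sineComb hx).continuousWithinAt

end SineComb

section IntegerPreserving

variable {R : Type*} [Ring R] [LinearOrder R] [FloorRing R]

theorem surjective_of_ordConnected_range_of_intCast_mem {α : Type*} {h : α → R} {k : ℤ → ℤ}
    (hr : (range h).OrdConnected) (hk : StrictMono k) (hkh : ∀ n, (k n : R) ∈ range h) :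
    Function.Surjective h := by
  intro y
  obtain ⟨_, ⟨m, rfl⟩, hm⟩ :=
    not_bddBelow_iff.1 hk.not_bddBelow_range_of_isPredArchimedean ⌊y⌋
  obtain ⟨_, ⟨n, rfl⟩, hn⟩ :=
    not_bddAbove_iff.1 hk.not_bddAbove_range_of_isSuccArchimedean ⌈y⌉
  exact hr.out (hkh m) (hkh n) ⟨Int.le_floor.1 hm.le, Int.ceil_le.1 hn.le⟩

variable [IsStrictOrderedRing R]

theorem surjective_and_exists_orderIso_int_of_strictMono {h : R → R} (hm : StrictMono h)
    (hr : (range h).OrdConnected) (hZ : ∀ x, x ∈ range ((↑) : ℤ → R) ↔ h x ∈ range ((↑) : ℤ → R)) :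
    Function.Surjective h ∧ ∃ k : ℤ ≃o ℤ, ∀ n : ℤ, (k n : R) = h n := by
  choose k hk using fun n : ℤ => (hZ n).1 (mem_range_self n)
  have hkmono : StrictMono k := fun m n hmn => by
    rw [← Int.cast_lt (R := R), hk, hk]
    exact hm (Int.cast_lt.2 hmn)
  have hsurj : Function.Surjective h :=
    surjective_of_ordConnected_range_of_intCast_mem hr hkmono fun n => ⟨n, (hk n).symm⟩
  have hksurj : Function.Surjective k := by
    intro m
    obtain ⟨x, hx⟩ := hsurj m
    obtain ⟨n, rfl⟩ := (hZ x).2 ⟨m, hx.symm⟩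
    exact ⟨n, Int.cast_injective (α := R) ((hk n).trans hx)⟩
  exact ⟨hsurj, hkmono.orderIsoOfSurjective k hksurj, hk⟩

theorem orderIso_int_apply_add (k : ℤ ≃o ℤ) (m n : ℤ) : k (m + n) = k m + n :=
  AddConstMapClass.map_add_int (AddConstMap.mk k k.map_succ : AddConstMap ℤ ℤ 1 1) m n

theorem orderIso_int_eq_refl_of_isLeast {Q : Set ℤ} {a : ℤ} {k : ℤ ≃o ℤ}
    (hkQ : IsLeast (k ⁻¹' Q) a) (hQ : IsLeast Q a) : k = OrderIso.refl ℤ := by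
  have hka : k a = a := by
    rw [← k.strictMono.map_isLeast, image_preimage_eq Q k.surjective] at hkQ
    exact hkQ.unique hQ
  ext n
  rw [← add_sub_cancel a n, orderIso_int_apply_add, hka, OrderIso.refl_apply]

end IntegerPreserving

section Rigidity

variable {P Q : Set ℤ} {h : ℝ → ℝ}

theorem ordConnected_image_of_graphTopology_sineComb
    (hPQ : graphTopology (sineComb P) = .induced h (graphTopology (sineComb Q))) {s : Set ℝ}
    (hs : s.OrdConnected) : (h '' s).OrdConnected :=
  (isPreconnected_image_of_graphTopology_eq_induced hPQ
    (isPreconnected_graphOn_sineComb hs)).ordConnected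

theorem ordConnected_range_of_graphTopology_sineComb
    (hPQ : graphTopology (sineComb P) = .induced h (graphTopology (sineComb Q))) :
    (range h).OrdConnected :=
  image_univ ▸ ordConnected_image_of_graphTopology_sineComb hPQ ordConnected_univ

theorem mem_range_intCast_iff_of_strictMono (hm : StrictMono h)
    (hPQ : graphTopology (sineComb P) = .induced h (graphTopology (sineComb Q))) (x : ℝ) :
    x ∈ range ((↑) : ℤ → ℝ) ↔ h x ∈ range ((↑) : ℤ → ℝ) := by
  have hmap := map_nhdsGT_of_strictMono hm (ordConnected_range_of_graphTopology_sineComb hPQ) x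
  have hiff := tendsto_iff_of_graphTopology_eq_induced hPQ (l := 𝓝[>] x)
    nhdsWithin_le_nhds (hmap ▸ nhdsWithin_le_nhds)
  rwa [hmap, tendsto_sineComb_nhdsGT_iff, tendsto_sineComb_nhdsGT_iff, not_iff_not] at hiff

theorem mem_image_intCast_iff_of_strictMono (hm : StrictMono h)
    (hPQ : graphTopology (sineComb P) = .induced h (graphTopology (sineComb Q))) (x : ℝ) :
    x ∈ ((↑) : ℤ → ℝ) '' P ↔ h x ∈ ((↑) : ℤ → ℝ) '' Q := by
  have hmap := map_nhdsLT_of_strictMono hm (ordConnected_range_of_graphTopology_sineComb hPQ) x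
  have hiff := tendsto_iff_of_graphTopology_eq_induced hPQ (l := 𝓝[<] x)
    nhdsWithin_le_nhds (hmap ▸ nhdsWithin_le_nhds)
  rwa [hmap, tendsto_sineComb_nhdsLT_iff, tendsto_sineComb_nhdsLT_iff, not_iff_not] at hiff

theorem mem_range_intCast_iff_mem_image_of_strictAnti (ha : StrictAnti h)
    (hPQ : graphTopology (sineComb P) = .induced h (graphTopology (sineComb Q))) (x : ℝ) :
    x ∈ range ((↑) : ℤ → ℝ) ↔ h x ∈ ((↑) : ℤ → ℝ) '' Q := by
  have hmap := map_nhdsGT_of_strictAnti ha (ordConnected_range_of_graphTopology_sineComb hPQ) x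
  have hiff := tendsto_iff_of_graphTopology_eq_induced hPQ (l := 𝓝[>] x)
    nhdsWithin_le_nhds (hmap ▸ nhdsWithin_le_nhds)
  rwa [hmap, tendsto_sineComb_nhdsGT_iff, tendsto_sineComb_nhdsLT_iff, not_iff_not] at hiff

theorem not_strictAnti_of_graphTopology_sineComb (hQ : BddBelow Q)
    (hPQ : graphTopology (sineComb P) = .induced h (graphTopology (sineComb Q))) :
    ¬StrictAnti h := by
  intro ha
  choose k hkQ hk using fun n : ℤ =>
    (mem_range_intCast_iff_mem_image_of_strictAnti ha hPQ n).1 (mem_range_self n)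
  have hkanti : StrictAnti k := fun m n hmn => by
    rw [← Int.cast_lt (R := ℝ), hk, hk]
    exact ha (Int.cast_lt.2 hmn)
  exact hkanti.not_bddBelow_range_of_isPredArchimedean (hQ.mono (range_subset_iff.2 hkQ))

theorem eq_and_surjective_of_graphTopology_sineComb {a : ℤ} (hP : IsLeast P a) (hQ : IsLeast Q a)
    (hinj : Function.Injective h)
    (hPQ : graphTopology (sineComb P) = .induced h (graphTopology (sineComb Q))) :
    P = Q ∧ Function.Surjective h := by
  have hm : StrictMono h :=
    (strictMono_or_strictAnti_of_ordConnected_image hinj fun _ =>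
      ordConnected_image_of_graphTopology_sineComb hPQ).resolve_right
        (not_strictAnti_of_graphTopology_sineComb ⟨a, hQ.2⟩ hPQ)
  obtain ⟨hsurj, k, hk⟩ := surjective_and_exists_orderIso_int_of_strictMono hm
    (ordConnected_range_of_graphTopology_sineComb hPQ) (mem_range_intCast_iff_of_strictMono hm hPQ)
  have hkQ : P = k ⁻¹' Q := by
    ext n
    rw [mem_preimage, ← Int.cast_injective (α := ℝ) |>.mem_set_image,
      mem_image_intCast_iff_of_strictMono hm hPQ, ← hk, Int.cast_injective.mem_set_image]
  have hk1 : k = OrderIso.refl ℤ := orderIso_int_eq_refl_of_isLeast (hkQ ▸ hP) hQ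
  exact ⟨by rw [hkQ, hk1]; rfl, hsurj⟩

end Rigidity

section CodedTopology

/-- The set of integers with least element `0` that codes a set `A` of natural numbers. -/
def leftMarks (A : Set ℕ) : Set ℤ :=
  insert 0 ((fun k : ℕ => (k : ℤ) + 1) '' A)

/-- The member of the family of topologies that is coded by a set `A` of natural numbers. -/
noncomputable abbrev codedTopology (A : Set ℕ) : TopologicalSpace ℝ :=
  graphTopology (sineComb (leftMarks A))

theorem isLeast_leftMarks (A : Set ℕ) : IsLeast (leftMarks A) 0 := by
  refine ⟨mem_insert _ _, ?_⟩
  rintro _ (rfl | ⟨k, -, rfl⟩)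
  · rfl
  · positivity

theorem natCast_add_one_mem_leftMarks_iff {A : Set ℕ} {k : ℕ} :
    (k : ℤ) + 1 ∈ leftMarks A ↔ k ∈ A := by
  have hinj : Function.Injective fun k : ℕ => (k : ℤ) + 1 := fun _ _ h => by simpa using h
  rw [leftMarks, mem_insert_iff, or_iff_right (by positivity)]
  exact hinj.mem_set_image

theorem leftMarks_injective : Function.Injective leftMarks := fun A B h => by
  ext k
  rw [← natCast_add_one_mem_leftMarks_iff, h, natCast_add_one_mem_leftMarks_iff]

theorem eq_and_surjective_of_codedTopology_eq_induced {A B : Set ℕ} {h : ℝ → ℝ}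
    (hinj : Function.Injective h) (hAB : codedTopology A = .induced h (codedTopology B)) :
    A = B ∧ Function.Surjective h :=
  (eq_and_surjective_of_graphTopology_sineComb (isLeast_leftMarks A) (isLeast_leftMarks B) hinj
    hAB).imp_left fun h => leftMarks_injective h

theorem codedTopology_injective : Function.Injective codedTopology := fun _ B h =>
  (eq_and_surjective_of_codedTopology_eq_induced Function.injective_id
    (h.trans (@induced_id ℝ (codedTopology B)).symm)).1

end CodedTopology

theorem exists_eq_induced_of_homeomorph {X Y : Type*} [tX : TopologicalSpace X]
    [tY : TopologicalSpace Y] {S : Set Y} (e : X ≃ₜ S) :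
    ∃ h : X → Y, Function.Injective h ∧ tX = .induced h tY ∧ range h = S :=
  have he : IsEmbedding (Subtype.val ∘ e) := IsEmbedding.subtypeVal.comp e.isEmbedding
  ⟨Subtype.val ∘ e, he.injective, he.eq_induced, by
    rw [e.surjective.range_comp, Subtype.range_coe]⟩

theorem corollary2 :
    ∃ T : Set (TopologicalSpace ℝ),
      Cardinal.mk T = Cardinal.continuum ∧
      (∀ τ ∈ T,
        τ ≤ euclideanTopology ∧
        @ConnectedSpace ℝ τ ∧
        @TopologicalSpace.SeparableSpace ℝ τ ∧
        @TopologicalSpace.IsCompletelyMetrizableSpace ℝ τ) ∧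
      IncomparableTopologies T := by
  refine ⟨range codedTopology, ?_, ?_, ?_⟩
  · rw [Cardinal.mk_range_eq _ codedTopology_injective, Cardinal.mk_set, Cardinal.mk_nat,
      Cardinal.two_power_aleph0]
  · rintro _ ⟨A, rfl⟩
    have hpolish := polishSpace_graphTopology_sineComb (leftMarks A)
    exact ⟨graphTopology_le _, connectedSpace_graphTopology_sineComb _,
      @SecondCountableTopology.to_separableSpace ℝ (codedTopology A)
        hpolish.toSecondCountableTopology,
      hpolish.toIsCompletelyMetrizableSpace⟩
  · rintro _ ⟨A, rfl⟩ _ ⟨B, rfl⟩ S ⟨e⟩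
    obtain ⟨h, hinj, hAB, rfl⟩ :=
      @exists_eq_induced_of_homeomorph ℝ ℝ (codedTopology A) (codedTopology B) S e
    obtain ⟨rfl, hsurj⟩ := eq_and_surjective_of_codedTopology_eq_induced hinj hAB
    exact ⟨rfl, hsurj.range_eq⟩
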